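/- Let $X$ be a locally compact Hausdorff space and let $k:X\times X\to[0,+\infty]$ be a symmetric kernel that is lower semicontinuous on $X\times X$. For $H\subset X$ let $\mathfrak M_1(H)$ be the set of all regular Borel probability measures $\mu$ on $X$ that are concentrated on $H$, i.e. such that $C\setminus H$ has outer $\mu$-measure $0$ for every compact $C\subset X$. Write $U^\mu(x)=\int_X k(x,y)\,d\mu(y)$ for the potential of $\mu$, and for $H,L\subset X$ put $$q(H,L)=\inf_{\mu\in\mathfrak M_1(H)}\ \sup_{x\in L}U^\mu(x),\qquad \underline q(H,L)=\sup_{\nu\in\mathfrak M_1(H)}\ \inf_{x\in L}U^\nu(x),$$ where all infima and suprema are taken in $[0,+\infty]$ (so $\inf\emptyset=+\infty$ and $\sup\emptyset=0$). Let $K\subset X$ be compact and let $L\subset X$ be an arbitrary subset, $K$ and $L$ not both empty. Then $$q(K,L)=\inf_{\mu\in\mathfrak M_1(K)}\ \sup_{\nu\in\mathfrak M_1(L)}\int_L\int_K k(x,y)\,d\mu(y)\,d\nu(x)=\sup_{\nu\in\mathfrak M_1(L)}\ \inf_{\mu\in\mathfrak M_1(K)}\int_L\int_K k(x,y)\,d\mu(y)\,d\nu(x),$$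 and moreover $q(K,L)=\underline q(L,K)$. -/

import Mathlib

open MeasureTheory
open scoped ENNReal

namespace PotentialTheory

variable {X : Type*} [TopologicalSpace X] [MeasurableSpace X]

/-- `μ` is concentrated on the (arbitrary) set `H`: every compact set meets the complement of `H`
in a set of outer measure zero. -/
def IsConcentratedOn (μ : Measure X) (H : Set X) : Prop :=
  ∀ C : Set X, IsCompact C → μ (C ∩ Hᶜ) = 0

/-- The set `𝔐₁(H)` of all regular Borel probability measures on `X` concentrated on `H`. -/
def probMeasuresOn (H : Set X) : Set (Measure X) :=
  {μ | IsProbabilityMeasure μ ∧ μ.Regular ∧ IsConcentratedOn μ H}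

/-- The potential `U^μ(x) = ∫ k(x, y) dμ(y)`. -/
noncomputable def potential (k : X → X → ℝ≥0∞) (μ : Measure X) (x : X) : ℝ≥0∞ :=
  ∫⁻ y, k x y ∂μ

/-- `Q(μ; H)`, the supremum of the potential of `μ` over `H`. -/
noncomputable def supPotential (k : X → X → ℝ≥0∞) (μ : Measure X) (H : Set X) : ℝ≥0∞ :=
  ⨆ x ∈ H, potential k μ x

/-- The infimum of the potential of `μ` over `H` (`Q` with an underline). -/
noncomputable def infPotential (k : X → X → ℝ≥0∞) (μ : Measure X) (H : Set X) : ℝ≥0∞ :=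
  ⨅ x ∈ H, potential k μ x

/-- The quasi-uniform energy `q(H, L) = inf_{μ ∈ 𝔐₁(H)} Q(μ; L)` of two sets. -/
noncomputable def quasiUniformEnergy (k : X → X → ℝ≥0∞) (H L : Set X) : ℝ≥0∞ :=
  ⨅ μ ∈ probMeasuresOn H, supPotential k μ L

/-- The dual quasi-uniform energy of two sets (`q` with an underline):
the supremum over `ν ∈ 𝔐₁(H)` of the infimum over `L` of the potential of `ν`. -/
noncomputable def dualQuasiUniformEnergy (k : X → X → ℝ≥0∞) (H L : Set X) : ℝ≥0∞ :=
  ⨆ ν ∈ probMeasuresOn H, infPotential k ν L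

end PotentialTheory

open Set Function
open scoped NNReal CompactlySupported

/-! The quantities form a cycle: `quasiUniformEnergy k K L` ≤ `dualQuasiUniformEnergy k L K` ≤
sup-inf ≤ inf-sup = `quasiUniformEnergy k K L`. The equality holds because Dirac measures recover
the point values of a potential.

The first inequality is the minimax step. If every potential of a measure in 𝔐₁(L) drops to t or
below somewhere on K, Hahn-Banach in `C(K, ℝ)` and the Riesz theorem give a probability measure μ on
K that integrates every continuous minorant of these potentials to at most t. Testing with Dirac
measures on L bounds the potential of μ on L by t.

The second inequality is half of Tonelli. Without countability assumptions k need not be measurable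
for the product σ-algebra, so k is first replaced by a single compactly supported continuous
minorant that is good for all points of K (`infPotential_le_lintegral`). -/

namespace PotentialTheory

/-! ### Lower semicontinuous functions approximated from below -/

section Approximation

variable {Y Z : Type*} [TopologicalSpace Y] [T2Space Y] [LocallyCompactSpace Y]
  [TopologicalSpace Z] [MeasurableSpace Z] [BorelSpace Z]

/-- Urysohn's lemma below a lower semicontinuous function. -/
lemma exists_compactlySupported_le_of_lt {h : Y → ℝ≥0∞} (hh : LowerSemicontinuous h)
    {s : Set Y} (hs : IsCompact s) {c : ℝ≥0} (hc : ∀ y ∈ s, (c : ℝ≥0∞) < h y) :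
    ∃ g : C_c(Y, ℝ≥0), (∀ y, (g y : ℝ≥0∞) ≤ h y) ∧ ∀ y ∈ s, g y = c := by
  have ht : IsClosed {y | h y ≤ c} := hh.isClosed_preimage c
  have hd : Disjoint s {y | h y ≤ c} :=
    Set.disjoint_left.2 fun y hy hy' => (hc y hy).not_ge hy'
  obtain ⟨f, f1, f0, fc, fI⟩ := exists_continuous_one_zero_of_isCompact hs ht hd
  refine ⟨⟨⟨fun y => c * (f y).toNNReal, by fun_prop⟩, ?_⟩, fun y => ?_, fun y hy => ?_⟩
  · exact fc.comp_left (g := fun r : ℝ => c * r.toNNReal) (by simp)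
  · change ((c * (f y).toNNReal : ℝ≥0) : ℝ≥0∞) ≤ h y
    by_cases hy : h y ≤ c
    · simp [f0 hy]
    · have : (f y).toNNReal ≤ 1 := by simpa using (fI y).2
      exact (ENNReal.coe_le_coe.2 (mul_le_of_le_one_right' this)).trans (not_le.1 hy).le
  · change c * (f y).toNNReal = c
    simp [f1 hy]

/-- A simple function strictly below a lower semicontinuous function is dominated, off a set of
small measure, by a compactly supported continuous function below it. -/
lemma exists_compactlySupported_ge_simpleFunc {h : Y → ℝ≥0∞} (hh : LowerSemicontinuous h)
    {ι : Z → Y} (hι : Continuous ι) (ν : Measure Z) [IsFiniteMeasure ν] [ν.InnerRegular]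
    [T2Space Z]
    (f : SimpleFunc Z ℝ≥0) (hf : ∀ z, f z = 0 ∨ (f z : ℝ≥0∞) < h (ι z))
    {ε : ℝ≥0∞} (hε : ε ≠ 0) :
    ∃ g : C_c(Y, ℝ≥0), (∀ y, (g y : ℝ≥0∞) ≤ h y) ∧
      ∃ C, MeasurableSet C ∧ ν Cᶜ ≤ ε ∧ ∀ z ∈ C, f z ≤ g (ι z) := by
  classical
  induction f using SimpleFunc.induction generalizing ε with
  | @const c s hs =>
    rcases eq_or_ne c 0 with rfl | hc
    · refine ⟨0, by simp, univ, .univ, by simp, fun z _ => ?_⟩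
      simp
    obtain ⟨C, hCs, hC, hνC⟩ := hs.exists_isCompact_sdiff_lt (μ := ν) (measure_ne_top _ _) hε
    obtain ⟨g, gh, gC⟩ := exists_compactlySupported_le_of_lt hh (hC.image hι) (c := c) (by
      rintro _ ⟨z, hz, rfl⟩
      have := hf z
      simpa [hCs hz, hc] using this)
    refine ⟨g, gh, sᶜ ∪ C, hs.compl.union hC.measurableSet, ?_, ?_⟩
    · rw [compl_union, compl_compl]; exact hνC.le
    · rintro z (hz | hz)
      · have : z ∉ s := hz
        simp [this]
      · simp [hCs hz, gC _ (mem_image_of_mem ι hz)]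
  | @add f₁ f₂ hd h₁ h₂ =>
    have key : ∀ z, f₁ z = 0 ∨ f₂ z = 0 := fun z => by
      by_contra! hz
      exact Set.disjoint_left.1 hd (mem_support.2 hz.1) (mem_support.2 hz.2)
    obtain ⟨g₁, g₁h, C₁, mC₁, νC₁, fg₁⟩ := h₁ (ε := ε / 2) (fun z => by
      rcases key z with hz | hz
      · exact .inl hz
      · simpa [hz] using hf z) (by simpa using hε)
    obtain ⟨g₂, g₂h, C₂, mC₂, νC₂, fg₂⟩ := h₂ (ε := ε / 2) (fun z => by
      rcases key z with hz | hz
      · simpa [hz] using hf z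
      · exact .inl hz) (by simpa using hε)
    -- The maximum stays below `h`, where a sum might not; it suffices because at each point one of
    -- `f₁`, `f₂` vanishes.
    refine ⟨g₁ ⊔ g₂, fun y => ?_, C₁ ∩ C₂, mC₁.inter mC₂, ?_, fun z hz => ?_⟩
    · rw [CompactlySupportedContinuousMap.sup_apply, ENNReal.coe_max]
      exact max_le (g₁h y) (g₂h y)
    · rw [compl_inter]
      exact (measure_union_le _ _).trans ((add_le_add νC₁ νC₂).trans (ENNReal.add_halves ε).le)
    · rw [CompactlySupportedContinuousMap.sup_apply]
      rcases key z with h0 | h0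
      · simpa [h0] using Or.inr (fg₂ z hz.2)
      · simpa [h0] using Or.inl (fg₁ z hz.1)

/-- The integral of a lower semicontinuous function along a continuous map is the supremum of the
integrals of the compactly supported continuous functions below it. -/
lemma exists_compactlySupported_lt_lintegral {h : Y → ℝ≥0∞} (hh : LowerSemicontinuous h)
    {ι : Z → Y} (hι : Continuous ι) (ν : Measure Z) [IsFiniteMeasure ν] [ν.InnerRegular]
    [T2Space Z] {t : ℝ≥0∞} (ht : t < ∫⁻ z, h (ι z) ∂ν) :
    ∃ g : C_c(Y, ℝ≥0), (∀ y, (g y : ℝ≥0∞) ≤ h y) ∧ t < ∫⁻ z, g (ι z) ∂ν := by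
  rw [lintegral_eq_nnreal] at ht
  simp only [lt_iSup_iff] at ht
  obtain ⟨φ, φh, hφ⟩ := ht
  rw [← SimpleFunc.lintegral_eq_lintegral] at hφ
  simp only [SimpleFunc.map_apply] at hφ
  obtain ⟨M, hM⟩ : ∃ M : ℝ≥0, ∀ z, φ z ≤ M := by
    obtain ⟨M, hM⟩ := φ.range.bddAbove
    exact ⟨M, fun z => hM (by simp)⟩
  -- Shrinking by `r < 1` makes `φ ≤ h` strict wherever `φ ≠ 0`, as the Urysohn step requires.
  obtain ⟨r, hr1, hr⟩ : ∃ r : ℝ≥0, r < 1 ∧ t < ∫⁻ z, (r * φ z : ℝ≥0) ∂ν := by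
    have h1 : ∀ r : ℝ≥0, ∫⁻ z, (r * φ z : ℝ≥0) ∂ν = r * ∫⁻ z, φ z ∂ν := fun r => by
      simp only [ENNReal.coe_mul]
      rw [lintegral_const_mul]
      exact φ.measurable.coe_nnreal_ennreal
    simp only [h1]
    have hfin : ∫⁻ z, φ z ∂ν ≠ ∞ := by
      refine ((lintegral_mono fun z => ENNReal.coe_le_coe.2 (hM z)).trans_lt ?_).ne
      simpa using ENNReal.mul_lt_top ENNReal.coe_lt_top (measure_lt_top ν _)
    have hlt : t / ∫⁻ z, φ z ∂ν < 1 := by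
      rw [ENNReal.div_lt_iff (.inl hφ.ne_bot) (.inl hfin)]
      simpa using hφ
    obtain ⟨r, hr, hr1⟩ := ENNReal.lt_iff_exists_nnreal_btwn.1 hlt
    refine ⟨r, by exact_mod_cast hr1, ?_⟩
    rwa [ENNReal.div_lt_iff (.inl hφ.ne_bot) (.inl hfin)] at hr
  -- `M * ε` bounds the loss on the exceptional set; the `+ 1` below covers `M = 0`.
  obtain ⟨ε, hε0, hε⟩ : ∃ ε : ℝ≥0∞, ε ≠ 0 ∧ t + M * ε < ∫⁻ z, (r * φ z : ℝ≥0) ∂ν := by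
    obtain ⟨δ, hδ0, hδ⟩ := ENNReal.lt_iff_exists_add_pos_lt.1 hr
    refine ⟨δ / (M + 1), ?_, lt_of_le_of_lt ?_ hδ⟩
    · simp [hδ0.ne']
    · gcongr
      rw [← mul_div_assoc]
      refine ENNReal.div_le_of_le_mul ?_
      rw [mul_comm]
      gcongr
      exact le_self_add
  obtain ⟨g, gh, C, mC, νC, hC⟩ := exists_compactlySupported_ge_simpleFunc hh hι ν
    (φ.map fun a => r * a) (fun z => by
      simp only [SimpleFunc.map_apply]
      rcases eq_or_ne (φ z) 0 with h0 | h0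
      · simp [h0]
      · refine .inr (lt_of_lt_of_le ?_ (φh z))
        exact_mod_cast mul_lt_of_lt_one_left (pos_iff_ne_zero.2 h0) hr1) hε0
  refine ⟨g, gh, ?_⟩
  have hle : ∫⁻ z, (r * φ z : ℝ≥0) ∂ν ≤ (∫⁻ z, g (ι z) ∂ν) + M * ε := by
    rw [← lintegral_add_compl _ mC]
    refine add_le_add ?_ ?_
    · refine (setLIntegral_mono' mC fun z hz => ?_).trans (setLIntegral_le_lintegral _ _)
      exact ENNReal.coe_le_coe.2 (hC z hz)
    · refine (setLIntegral_mono' mC.compl fun z _ =>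
        ENNReal.coe_le_coe.2 ((mul_le_of_le_one_left' hr1.le).trans (hM z))).trans ?_
      rw [setLIntegral_const]
      gcongr
  have hfin : (M : ℝ≥0∞) * ε ≠ ∞ := fun h => by simp [h] at hε
  exact (ENNReal.add_lt_add_iff_right hfin).1 (hε.trans_le hle)

end Approximation

/-! ### Fubini for compactly supported continuous functions -/

section Fubini

variable {Y Z : Type*} [TopologicalSpace Y] [TopologicalSpace Z]

lemma continuous_prod_left (g : C_c(Y × Z, ℝ≥0)) (z : Z) : Continuous fun y => g (y, z) :=
  (map_continuous g).comp (by fun_prop)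

variable [MeasurableSpace Y] [BorelSpace Y]

lemma lintegral_prod_left [T2Space Y] (g : C_c(Y × Z, ℝ≥0)) (ν : Measure Y) [IsFiniteMeasureOnCompacts ν]
    (z : Z) : ∫⁻ y, g (y, z) ∂ν = ENNReal.ofReal (∫ y, (g (y, z) : ℝ) ∂ν) := by
  refine lintegral_coe_eq_integral _ (Continuous.integrable_of_hasCompactSupport ?_ ?_)
  · exact NNReal.continuous_coe.comp (continuous_prod_left g z)
  · refine HasCompactSupport.intro (g.hasCompactSupport.isCompact.image continuous_fst)
      fun y hy => ?_
    rw [NNReal.coe_eq_zero]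
    by_contra h
    exact hy ⟨(y, z), subset_tsupport _ h, rfl⟩

lemma continuous_integral_prod_left (g : C_c(Y × Z, ℝ≥0)) (ν : Measure Y)
    [IsFiniteMeasureOnCompacts ν] : Continuous fun z => ∫ y, (g (y, z) : ℝ) ∂ν := by
  rw [← continuousOn_univ]
  refine continuousOn_integral_of_compact_support
    (g.hasCompactSupport.isCompact.image continuous_fst) ?_ fun z y _ hy => ?_
  · refine (NNReal.continuous_coe.comp ((map_continuous g).comp ?_)).continuousOn
      (f := fun p : Z × Y => ((g (p.2, p.1) : ℝ≥0) : ℝ))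
    fun_prop
  · rw [NNReal.coe_eq_zero]
    by_contra h
    exact hy ⟨(y, z), subset_tsupport _ h, rfl⟩

lemma continuous_lintegral_prod_left [T2Space Y] (g : C_c(Y × Z, ℝ≥0)) (ν : Measure Y)
    [IsFiniteMeasureOnCompacts ν] : Continuous fun z => ∫⁻ y, g (y, z) ∂ν := by
  simp only [lintegral_prod_left]
  exact ENNReal.continuous_ofReal.comp (continuous_integral_prod_left g ν)

variable [T2Space Y] [MeasurableSpace Z] [BorelSpace Z] [T2Space Z]

lemma lintegral_lintegral_prod_left (g : C_c(Y × Z, ℝ≥0)) (ν : Measure Y) (μ : Measure Z)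
    [IsFiniteMeasureOnCompacts ν] [IsFiniteMeasureOnCompacts μ] :
    ∫⁻ z, ∫⁻ y, g (y, z) ∂ν ∂μ = ENNReal.ofReal (∫ z, ∫ y, (g (y, z) : ℝ) ∂ν ∂μ) := by
  simp only [lintegral_prod_left]
  refine (ofReal_integral_eq_lintegral_ofReal ?_ ?_).symm
  · refine (continuous_integral_prod_left g ν).integrable_of_hasCompactSupport ?_
    refine HasCompactSupport.intro (g.hasCompactSupport.isCompact.image continuous_snd)
      fun z hz => ?_
    refine integral_eq_zero_of_ae (.of_forall fun y => ?_)
    rw [Pi.zero_apply, NNReal.coe_eq_zero]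
    by_contra h
    exact hz ⟨(y, z), subset_tsupport _ h, rfl⟩
  · exact .of_forall fun z => integral_nonneg fun y => NNReal.coe_nonneg _

/-- Fubini's theorem for compactly supported continuous functions and the lower integral. -/
lemma lintegral_lintegral_swap_compactlySupported (g : C_c(Y × Z, ℝ≥0)) (ν : Measure Y)
    (μ : Measure Z) [IsFiniteMeasureOnCompacts ν] [IsFiniteMeasureOnCompacts μ] :
    ∫⁻ z, ∫⁻ y, g (y, z) ∂ν ∂μ = ∫⁻ y, ∫⁻ z, g (y, z) ∂μ ∂ν := by
  let g' : C_c(Z × Y, ℝ≥0) := ⟨⟨fun p => g p.swap, (map_continuous g).comp continuous_swap⟩,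
    g.hasCompactSupport.comp_homeomorph (Homeomorph.prodComm Z Y)⟩
  have h := lintegral_lintegral_prod_left g' μ ν
  change ∫⁻ y, ∫⁻ z, g (y, z) ∂μ ∂ν = ENNReal.ofReal (∫ y, ∫ z, (g (y, z) : ℝ) ∂μ ∂ν) at h
  rw [lintegral_lintegral_prod_left, h]
  congr 1
  refine (integral_integral_swap_of_hasCompactSupport (f := fun y z => (g (y, z) : ℝ)) ?_ ?_).symm
  · exact NNReal.continuous_coe.comp (map_continuous g)
  · exact g.hasCompactSupport.comp_left (g := fun r : ℝ≥0 => (r : ℝ)) NNReal.coe_zero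

end Fubini

/-! ### Measures concentrated on a set, and mutual energies -/

section Measures

variable {X : Type*} [TopologicalSpace X] [T2Space X] [MeasurableSpace X] [BorelSpace X]
  {H K L : Set X} {k : X → X → ℝ≥0∞}

/-- Inner regularity exhausts the finite measure by compact sets up to ε. `H` need not be
measurable; outer measure suffices. -/
lemma measure_compl_eq_zero_of_mem {μ : Measure X} (hμ : μ ∈ probMeasuresOn H) : μ Hᶜ = 0 := by
  obtain ⟨_, _, hc⟩ := hμ
  refine nonpos_iff_eq_zero.1 (ENNReal.le_of_forall_pos_le_add fun ε hε _ => ?_)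
  obtain ⟨C, -, hC, hCε⟩ := MeasurableSet.univ.exists_isCompact_sdiff_lt (μ := μ)
    (measure_ne_top _ _) (ε := ε) (by simpa using hε.ne')
  calc μ Hᶜ ≤ μ ((C ∩ Hᶜ) ∪ (univ \ C)) := measure_mono fun x hx => by
        by_cases h : x ∈ C
        · exact .inl ⟨h, hx⟩
        · exact .inr ⟨trivial, h⟩
    _ ≤ μ (C ∩ Hᶜ) + μ (univ \ C) := measure_union_le _ _
    _ ≤ 0 + ε := add_le_add (hc C hC).le hCε.le

lemma ae_mem_of_mem {μ : Measure X} (hμ : μ ∈ probMeasuresOn H) : ∀ᵐ x ∂μ, x ∈ H :=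
  measure_compl_eq_zero_of_mem hμ

lemma restrict_eq_self_of_mem {μ : Measure X} (hμ : μ ∈ probMeasuresOn H) : μ.restrict H = μ :=
  Measure.restrict_eq_self_of_ae_mem (ae_mem_of_mem hμ)

lemma mem_probMeasuresOn {μ : Measure X} [IsProbabilityMeasure μ] [μ.InnerRegular]
    (h : μ Hᶜ = 0) : μ ∈ probMeasuresOn H :=
  ⟨inferInstance, inferInstance, fun _ _ => measure_mono_null inter_subset_right h⟩

lemma dirac_mem_probMeasuresOn {x : X} (hx : x ∈ H) : Measure.dirac x ∈ probMeasuresOn H := by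
  have : (Measure.dirac x).InnerRegular := by
    refine ⟨fun s hs r hr => ?_⟩
    by_cases hxs : x ∈ s
    · exact ⟨{x}, by simpa using hxs, isCompact_singleton, by simpa [hxs] using hr⟩
    · simp [hxs] at hr
  refine mem_probMeasuresOn ?_
  simp [hx]

lemma convexCombination_mem_probMeasuresOn {μ ν : Measure X} (hμ : μ ∈ probMeasuresOn H)
    (hν : ν ∈ probMeasuresOn H) {a b : ℝ≥0∞} (hab : a + b = 1) :
    a • μ + b • ν ∈ probMeasuresOn H := by
  have hμ0 := measure_compl_eq_zero_of_mem hμ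
  have hν0 := measure_compl_eq_zero_of_mem hν
  obtain ⟨_, _, -⟩ := hμ
  obtain ⟨_, _, -⟩ := hν
  have : IsProbabilityMeasure (a • μ + b • ν) := ⟨by simp [hab]⟩
  refine mem_probMeasuresOn ?_
  simp [hμ0, hν0]

/-- Dirac measures give ≤; an average over `L` never exceeds the supremum. -/
lemma supPotential_eq_iSup_lintegral (k : X → X → ℝ≥0∞) {μ : Measure X}
    (hμ : μ ∈ probMeasuresOn K) :
    supPotential k μ L = ⨆ ν ∈ probMeasuresOn L, ∫⁻ x in L, (∫⁻ y in K, k x y ∂μ) ∂ν := by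
  rw [restrict_eq_self_of_mem hμ]
  refine le_antisymm (iSup₂_le fun x hx => ?_) (iSup₂_le fun ν hν => ?_)
  · refine le_iSup₂_of_le _ (dirac_mem_probMeasuresOn hx) ?_
    rw [restrict_eq_self_of_mem (dirac_mem_probMeasuresOn hx), lintegral_dirac]
    rfl
  · rw [restrict_eq_self_of_mem hν]
    have := hν.1
    calc ∫⁻ x, ∫⁻ y, k x y ∂μ ∂ν ≤ ∫⁻ _, supPotential k μ L ∂ν :=
          lintegral_mono_ae ((ae_mem_of_mem hν).mono fun x hx => le_iSup₂_of_le x hx le_rfl)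
      _ = supPotential k μ L := by simp

lemma quasiUniformEnergy_eq_iInf_iSup (k : X → X → ℝ≥0∞) :
    quasiUniformEnergy k K L = ⨅ μ ∈ probMeasuresOn K, ⨆ ν ∈ probMeasuresOn L,
      ∫⁻ x in L, (∫⁻ y in K, k x y ∂μ) ∂ν :=
  iInf_congr fun _ => iInf_congr fun hμ => supPotential_eq_iSup_lintegral k hμ

variable [LocallyCompactSpace X]

/-- One half of Fubini's theorem for lower semicontinuous kernels: a uniform lower bound on `K` for
the potential of `ν` bounds the mutual energy of `ν` with every probability measure on `K`. -/
lemma infPotential_le_lintegral (hk_lsc : LowerSemicontinuous (fun p : X × X => k p.1 p.2))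
    (hk_symm : ∀ x y : X, k x y = k y x) (hK : IsCompact K) {μ ν : Measure X}
    (hμ : μ ∈ probMeasuresOn K) [IsFiniteMeasure ν] [ν.InnerRegular] :
    infPotential k ν K ≤ ∫⁻ x, ∫⁻ y, k x y ∂μ ∂ν := by
  refine le_of_forall_lt fun t ht => ?_
  obtain ⟨s, hts, hs⟩ := exists_between ht
  have hpt : ∀ y ∈ K, ∃ g : C_c(X × X, ℝ≥0), (∀ p, (g p : ℝ≥0∞) ≤ k p.1 p.2) ∧
      s < ∫⁻ x, g (x, y) ∂ν := fun y hy => by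
    refine exists_compactlySupported_lt_lintegral hk_lsc (ι := fun x => (x, y)) (by fun_prop) ν ?_
    refine hs.trans_le ((iInf₂_le y hy).trans_eq ?_)
    exact lintegral_congr fun x => hk_symm y x
  obtain ⟨g, gk, hg⟩ : ∃ g : C_c(X × X, ℝ≥0), (∀ p, (g p : ℝ≥0∞) ≤ k p.1 p.2) ∧
      ∀ y ∈ K, s < ∫⁻ x, g (x, y) ∂ν := by
    -- Minorants for two sets combine by maximum, and the strict inequality persists near `y`
    -- because the potential of `g` is continuous.
    refine hK.induction_on (p := fun S => ∃ g : C_c(X × X, ℝ≥0),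
      (∀ p, (g p : ℝ≥0∞) ≤ k p.1 p.2) ∧ ∀ y ∈ S, s < ∫⁻ x, g (x, y) ∂ν) ?_ ?_ ?_ ?_
    · exact ⟨0, by simp, by simp⟩
    · exact fun S T hST ⟨g, gk, hg⟩ => ⟨g, gk, fun y hy => hg y (hST hy)⟩
    · rintro S T ⟨g₁, g₁k, hg₁⟩ ⟨g₂, g₂k, hg₂⟩
      refine ⟨g₁ ⊔ g₂, fun p => ?_, ?_⟩
      · rw [CompactlySupportedContinuousMap.sup_apply, ENNReal.coe_max]
        exact max_le (g₁k p) (g₂k p)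
      · simp only [CompactlySupportedContinuousMap.sup_apply, ENNReal.coe_max]
        rintro y (hy | hy)
        · exact (hg₁ y hy).trans_le (lintegral_mono fun x => le_max_left _ _)
        · exact (hg₂ y hy).trans_le (lintegral_mono fun x => le_max_right _ _)
    · intro y hy
      obtain ⟨g, gk, hg⟩ := hpt y hy
      exact ⟨{z | s < ∫⁻ x, g (x, z) ∂ν}, mem_nhdsWithin_of_mem_nhds
        ((isOpen_lt continuous_const (continuous_lintegral_prod_left g ν)).mem_nhds hg),
        g, gk, fun z hz => hz⟩
  have := hμ.1
  calc t < s := hts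
    _ = ∫⁻ _, s ∂μ := by simp
    _ ≤ ∫⁻ y, ∫⁻ x, g (x, y) ∂ν ∂μ :=
      lintegral_mono_ae ((ae_mem_of_mem hμ).mono fun y hy => (hg y hy).le)
    _ = ∫⁻ x, ∫⁻ y, g (x, y) ∂μ ∂ν := lintegral_lintegral_swap_compactlySupported g ν μ
    _ ≤ ∫⁻ x, ∫⁻ y, k x y ∂μ ∂ν := by gcongr with x y; exact gk (x, y)

end Measures

/-! ### Hahn-Banach separation and Riesz representation -/

section Separation

variable {Z : Type*} [TopologicalSpace Z] [CompactSpace Z]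

/-- A convex set of continuous functions, each of which is somewhere at most `t`, is at most `t` on
a normalized positive linear functional. -/
lemma exists_positive_functional_le {A : Set C(Z, ℝ)} (hA : Convex ℝ A) (h0 : 0 ∈ A) {t : ℝ}
    (ht : 0 ≤ t) (hAt : ∀ g ∈ A, ∃ z, g z ≤ t) :
    ∃ φ : C(Z, ℝ) →ₗ[ℝ] ℝ, (∀ g, 0 ≤ g → 0 ≤ φ g) ∧ φ 1 = 1 ∧ ∀ g ∈ A, φ g ≤ t := by
  let B : Set C(Z, ℝ) := {g | ∀ z, t < g z}
  have hB : Convex ℝ B := by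
    intro f hf g hg a b ha hb hab z
    exact (convex_Ioi t) (hf z) (hg z) ha hb hab
  have hBo : IsOpen B := by
    have : B = {g : C(Z, ℝ) | MapsTo g univ (Ioi t)} := by ext; simp [B, MapsTo]
    rw [this]
    exact ContinuousMap.isOpen_setOfPred_mapsTo isCompact_univ isOpen_Ioi
  have hd : Disjoint B A := Set.disjoint_left.2 fun g hgB hgA => by
    obtain ⟨z, hz⟩ := hAt g hgA
    exact (hgB z).not_ge hz
  obtain ⟨f, u, hfB, hfA⟩ := geometric_hahn_banach_open hB hBo hA hd
  have hu : u ≤ 0 := by simpa using hfA 0 h0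
  have hconst : ∀ c : ℝ, t < c → c * f 1 < u := fun c hc => by
    have := hfB (c • 1) (fun z => by simpa using hc)
    simpa using this
  have hf1 : f 1 < 0 := by
    have h := hconst (t + 1) (by linarith)
    by_contra! h'
    have : 0 ≤ (t + 1) * f 1 := by positivity
    linarith
  -- If `f g > 0`, then `(t + 1) + n g` lies in `B` for every n, yet `f` is positive on it for large
  -- n, contradicting `u ≤ 0`.
  have hpos : ∀ g : C(Z, ℝ), 0 ≤ g → f g ≤ 0 := fun g hg => by
    by_contra! h
    obtain ⟨n, hn⟩ := exists_nat_gt (-((t + 1) * f 1) / f g)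
    rw [div_lt_iff₀ h] at hn
    have := hfB ((t + 1) • 1 + (n : ℝ) • g) (fun z => by
      have : 0 ≤ (n : ℝ) * g z := mul_nonneg n.cast_nonneg (hg z)
      simp only [ContinuousMap.add_apply, ContinuousMap.smul_apply, ContinuousMap.one_apply,
        smul_eq_mul]
      linarith)
    rw [map_add, map_smul, map_smul, smul_eq_mul, smul_eq_mul] at this
    linarith
  refine ⟨(f 1)⁻¹ • (f : C(Z, ℝ) →ₗ[ℝ] ℝ), fun g hg => ?_, ?_, fun g hg => ?_⟩
  · exact mul_nonneg_of_nonpos_of_nonpos (inv_nonpos.2 hf1.le) (hpos g hg)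
  · exact inv_mul_cancel₀ hf1.ne
  · change (f 1)⁻¹ * f g ≤ t
    refine le_of_forall_gt_imp_ge_of_dense fun c hc => ?_
    rw [inv_mul_eq_div, div_le_iff_of_neg hf1]
    exact (hconst c hc).le.trans (hfA g hg)

/-- The measure version of `exists_positive_functional_le`. -/
lemma exists_probabilityMeasure_integral_le [T2Space Z] [MeasurableSpace Z] [BorelSpace Z]
    {A : Set C(Z, ℝ)} (hA : Convex ℝ A) (h0 : 0 ∈ A) {t : ℝ}
    (ht : 0 ≤ t) (hAt : ∀ g ∈ A, ∃ z, g z ≤ t) :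
    ∃ μ : Measure Z, IsProbabilityMeasure μ ∧ μ.Regular ∧ ∀ g ∈ A, ∫ z, g z ∂μ ≤ t := by
  obtain ⟨φ, hφ, hφ1, hφA⟩ := exists_positive_functional_le hA h0 ht hAt
  let Λ : C_c(Z, ℝ) →ₚ[ℝ] ℝ := PositiveLinearMap.mk₀
    { toFun := fun g => φ g.toContinuousMap
      map_add' := fun f g => φ.map_add f.toContinuousMap g.toContinuousMap
      map_smul' := fun c g => φ.map_smul c g.toContinuousMap }
    fun g hg => hφ _ hg
  have hΛ : ∀ g : C(Z, ℝ), ∫ z, g z ∂(RealRMK.rieszMeasure Λ) = φ g := fun g =>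
    RealRMK.integral_rieszMeasure Λ ⟨g, HasCompactSupport.of_compactSpace g⟩
  refine ⟨RealRMK.rieszMeasure Λ, ⟨?_⟩, inferInstance, fun g hg => (hΛ g).trans_le (hφA g hg)⟩
  have := hΛ 1
  rw [hφ1] at this
  simpa [measureReal_def, ENNReal.toReal_eq_one_iff] using this

end Separation

/-! ### The minimax inequality -/

section Minimax

variable {X : Type*} [TopologicalSpace X] [T2Space X] [LocallyCompactSpace X]
  [MeasurableSpace X] [BorelSpace X] {K L : Set X} {k : X → X → ℝ≥0∞}

lemma quasiUniformEnergy_le_dual_of_nonempty (hk_lsc : LowerSemicontinuous (fun p : X × X => k p.1 p.2))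
    (hk_symm : ∀ x y : X, k x y = k y x) (hK : IsCompact K) (hLn : L.Nonempty) :
    quasiUniformEnergy k K L ≤ dualQuasiUniformEnergy k L K := by
  refine le_of_forall_gt_imp_ge_of_dense fun t' ht' => ?_
  rcases eq_or_ne t' ∞ with rfl | htop
  · exact le_top
  lift t' to ℝ≥0 using htop
  have : CompactSpace K := isCompact_iff_compactSpace.1 hK
  -- Potentials are only lower semicontinuous and may be infinite, so their continuous minorants
  -- stand in for them.
  let A : Set C(K, ℝ) :=
    {g | ∃ ν ∈ probMeasuresOn L, ∀ y : K, ENNReal.ofReal (g y) ≤ potential k ν y}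
  have hA : Convex ℝ A := by
    rintro f ⟨ν₁, hν₁, hf⟩ g ⟨ν₂, hν₂, hg⟩ a b ha hb hab
    refine ⟨ENNReal.ofReal a • ν₁ + ENNReal.ofReal b • ν₂,
      convexCombination_mem_probMeasuresOn hν₁ hν₂ ?_, fun y => ?_⟩
    · rw [← ENNReal.ofReal_add ha hb, hab, ENNReal.ofReal_one]
    · simp only [ContinuousMap.add_apply, ContinuousMap.smul_apply, smul_eq_mul]
      refine ENNReal.ofReal_add_le.trans ?_
      rw [ENNReal.ofReal_mul ha, ENNReal.ofReal_mul hb, potential, lintegral_add_measure,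
        lintegral_smul_measure, lintegral_smul_measure]
      exact add_le_add (mul_le_mul_right (hf y) _) (mul_le_mul_right (hg y) _)
  have h0 : (0 : C(K, ℝ)) ∈ A := by
    obtain ⟨x, hx⟩ := hLn
    exact ⟨_, dirac_mem_probMeasuresOn hx, by simp⟩
  have hAt : ∀ g ∈ A, ∃ z, g z ≤ t' := by
    rintro g ⟨ν, hν, hg⟩
    by_contra! h
    refine ht'.not_ge (le_iSup₂_of_le ν hν (le_iInf₂ fun y hy => ?_))
    refine le_trans ?_ (hg ⟨y, hy⟩)
    rw [← ENNReal.ofReal_coe_nnreal]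
    exact ENNReal.ofReal_le_ofReal (h _).le
  obtain ⟨μ, _, _, hμ⟩ := exists_probabilityMeasure_integral_le hA h0 t'.coe_nonneg hAt
  have hval : Measurable ((↑) : K → X) := measurable_subtype_coe
  have hmap : μ.map (↑) ∈ probMeasuresOn K := by
    have : IsProbabilityMeasure (μ.map ((↑) : K → X)) :=
      Measure.isProbabilityMeasure_map hval.aemeasurable
    have : (μ.map ((↑) : K → X)).InnerRegular :=
      Measure.InnerRegular.map_of_continuous continuous_subtype_val
    refine mem_probMeasuresOn ?_
    rw [Measure.map_apply hval hK.measurableSet.compl]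
    simp
  refine iInf₂_le_of_le _ hmap (iSup₂_le fun x hx => ?_)
  have hkx : LowerSemicontinuous (k x) :=
    hk_lsc.comp (g := fun y => (x, y)) (by fun_prop)
  rw [potential, lintegral_map hkx.measurable hval]
  refine le_of_forall_lt fun s hs => ?_
  obtain ⟨g, gk, hg⟩ := exists_compactlySupported_lt_lintegral hkx continuous_subtype_val μ hs
  have hgc : Continuous fun y : K => (g y : ℝ) :=
    NNReal.continuous_coe.comp ((map_continuous g).comp continuous_subtype_val)
  refine hg.trans_le ?_
  rw [lintegral_coe_eq_integral _
    (hgc.integrable_of_hasCompactSupport (HasCompactSupport.of_compactSpace _)),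
    ← ENNReal.ofReal_coe_nnreal]
  -- By symmetry `k x` is the potential of the Dirac measure at `x`, so its minorant `g` belongs to
  -- `A`.
  refine ENNReal.ofReal_le_ofReal (hμ ⟨_, hgc⟩ ⟨_, dirac_mem_probMeasuresOn hx, fun y => ?_⟩)
  rw [potential, lintegral_dirac, hk_symm]
  simpa using gk y

lemma quasiUniformEnergy_le_dual (hk_lsc : LowerSemicontinuous (fun p : X × X => k p.1 p.2))
    (hk_symm : ∀ x y : X, k x y = k y x) (hK : IsCompact K) (hKL : K.Nonempty ∨ L.Nonempty) :
    quasiUniformEnergy k K L ≤ dualQuasiUniformEnergy k L K := by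
  rcases L.eq_empty_or_nonempty with rfl | hL
  · obtain ⟨x, hx⟩ := hKL.resolve_right Set.not_nonempty_empty
    exact iInf₂_le_of_le _ (dirac_mem_probMeasuresOn hx) (by simp [supPotential])
  · exact quasiUniformEnergy_le_dual_of_nonempty hk_lsc hk_symm hK hL

lemma dual_le_iSup_iInf (hk_lsc : LowerSemicontinuous (fun p : X × X => k p.1 p.2))
    (hk_symm : ∀ x y : X, k x y = k y x) (hK : IsCompact K) :
    dualQuasiUniformEnergy k L K ≤ ⨆ ν ∈ probMeasuresOn L, ⨅ μ ∈ probMeasuresOn K,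
      ∫⁻ x in L, (∫⁻ y in K, k x y ∂μ) ∂ν := by
  refine iSup₂_mono fun ν hν => le_iInf₂ fun μ hμ => ?_
  rw [restrict_eq_self_of_mem hν, restrict_eq_self_of_mem hμ]
  obtain ⟨_, _, -⟩ := hν
  exact infPotential_le_lintegral hk_lsc hk_symm hK hμ

lemma iSup₂_iInf₂_le_iInf₂_iSup₂ {α β γ : Type*} [CompleteLattice γ] (S : Set α) (T : Set β)
    (f : α → β → γ) : ⨆ b ∈ T, ⨅ a ∈ S, f a b ≤ ⨅ a ∈ S, ⨆ b ∈ T, f a b :=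
  iSup₂_le fun b hb => le_iInf₂ fun a ha =>
    (iInf₂_le a ha).trans (le_iSup₂ (f := fun b _ => f a b) b hb)

end Minimax

end PotentialTheory

theorem mainTheorem4 {X : Type*} [TopologicalSpace X] [T2Space X] [LocallyCompactSpace X]
    [MeasurableSpace X] [BorelSpace X]
    (k : X → X → ℝ≥0∞)
    (hk_lsc : LowerSemicontinuous (fun p : X × X => k p.1 p.2))
    (hk_symm : ∀ x y : X, k x y = k y x)
    (K L : Set X) (hK : IsCompact K) (hKL : K.Nonempty ∨ L.Nonempty) :
    PotentialTheory.quasiUniformEnergy k K L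
        = (⨅ μ ∈ PotentialTheory.probMeasuresOn K, ⨆ ν ∈ PotentialTheory.probMeasuresOn L,
            ∫⁻ x in L, (∫⁻ y in K, k x y ∂μ) ∂ν) ∧
      PotentialTheory.quasiUniformEnergy k K L
        = (⨆ ν ∈ PotentialTheory.probMeasuresOn L, ⨅ μ ∈ PotentialTheory.probMeasuresOn K,
            ∫⁻ x in L, (∫⁻ y in K, k x y ∂μ) ∂ν) ∧
      PotentialTheory.quasiUniformEnergy k K L
        = PotentialTheory.dualQuasiUniformEnergy k L K := by
  have h₁ := PotentialTheory.quasiUniformEnergy_eq_iInf_iSup (K := K) (L := L) k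
  have h₂ := PotentialTheory.dual_le_iSup_iInf (L := L) hk_lsc hk_symm hK
  have h₃ := PotentialTheory.quasiUniformEnergy_le_dual hk_lsc hk_symm hK hKL
  have h₄ := (PotentialTheory.iSup₂_iInf₂_le_iInf₂_iSup₂ (PotentialTheory.probMeasuresOn K)
    (PotentialTheory.probMeasuresOn L)
    fun μ ν => ∫⁻ x in L, (∫⁻ y in K, k x y ∂μ) ∂ν).trans h₁.ge
  exact ⟨h₁, (h₃.trans h₂).antisymm h₄, h₃.antisymm (h₂.trans h₄)⟩
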